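/- **Biquandles.** A biquandle is a set with four binary operations, written here $a^{b}$, $a_{b}$, $a^{\bar b}$, $a_{\bar b}$ (operations associate to the left), such that for all elements $a,b,c$: (1) there is $x$ with $(a^{x})_{a}=a$; (2) there is $x$ with $x=a_{\bar x}$ and $a=x^{\bar a}$; (3) $a=(a_{b})_{\overline{b^{a}}}=(a^{b})^{\overline{b_{a}}}=(a^{\bar b})^{\,b_{\bar a}}=(a_{\bar b})_{\,b^{\bar a}}$; (4) there is $x$ with $x=a^{\,b_{\bar x}}$, $a=x^{\bar b}$ and $b=(b_{\bar x})_{a}$; (5) $(a^{b})^{c}=(a^{c_{b}})^{b^{c}}$, $\;(a_{b})_{c}=(a_{c^{b}})_{b_{c}}$, $\;(a_{b})^{c_{(b^{a})}}=(a^{c})_{b^{(c_{a})}}$; together with the variants of (1), (2), (4), (5) in which each operation is exchanged with its barred counterpart. **Diagrams.** An oriented virtual knot diagram $K$ (with any number of components) is a generic smooth immersion of finitely many oriented circles in $\mathbb R^2$, with finitely many double points, all of them transverse, and no triple points, where each double point is labelled either as a real crossing (with an over and an under strand) or as a virtual crossing. Its arcs run from one real crossing to the next, over or under, passing through virtual crossings;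 a component without real crossings is one arc. **The biquandle of a diagram.** Each real crossing gives two relations. Let $o,u$ be the incoming and $o',u'$ the outgoing arcs of its over and under strand. At a positive crossing (one where the directions of the over and the under strand, in this order, form a positively oriented basis of the plane) the relations are $o'=o_{u}$ and $u'=u^{o}$. At a negative crossing they are $o'=o_{\bar u}$ and $u'=u^{\bar o}$. A biquandle $A$ is called *a biquandle for $K$* if it is generated, under the four operations, by elements indexed by the arcs of $K$ that satisfy these relations. $BQ(K)$ denotes the biquandle presented by the arcs as generators and these relations: expressions are formed with the four operations and one further operation for each element whose existence axioms (1), (2), (4) and their variants assert, and they are taken modulo the congruence generated by the axioms and the relations. **Vertical mirror image.** $K^\uparrow$ is obtained from $K$ by reflecting the plane in a vertical line, keeping over strands over and virtual crossings virtual, and reversing the orientation of all components. (So the vertical mirror image of the closure of a virtual braid $\beta$ is the closure of $\beta^{-1}$.) **Corollary.** For every oriented virtual knot diagram $K$ we have $BQ(K)\cong BQ(K^\uparrow)$ as biquandles. Moreover, a biquandle is a biquandle for $K$ if and only if it is a biquandle for $K^\uparrow$. -/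

import Mathlib

open scoped ContDiff Topology
open Filter

/-! ### Biquandles -/

/-- Four binary operations, named after the position of the operator bar:
`ur a b` is `a` with the upper right bar over `b`, `lr` lower right, `ul` upper left,
`ll` lower left. -/
class BiquandleOps (A : Type*) where
  ur : A → A → A
  lr : A → A → A
  ul : A → A → A
  ll : A → A → A

open BiquandleOps in
/-- A biquandle. A name ending in `_var` is the left/right variant (exchange `ur` with `ul` and
`lr` with `ll`) of the axiom before it. -/
class Biquandle (A : Type*) extends BiquandleOps A where
  ax1 : ∀ a : A, ∃ x : A, lr (ur a x) a = a
  ax1_var : ∀ a : A, ∃ x : A, ll (ul a x) a = a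
  ax2 : ∀ a : A, ∃ x : A, x = ll a x ∧ a = ul x a
  ax2_var : ∀ a : A, ∃ x : A, x = lr a x ∧ a = ur x a
  ax3_lr : ∀ a b : A, a = ll (lr a b) (ur b a)
  ax3_ur : ∀ a b : A, a = ul (ur a b) (lr b a)
  ax3_ul : ∀ a b : A, a = ur (ul a b) (ll b a)
  ax3_ll : ∀ a b : A, a = lr (ll a b) (ul b a)
  ax4 : ∀ a b : A, ∃ x : A, x = ur a (ll b x) ∧ a = ul x b ∧ b = lr (ll b x) a
  ax4_var : ∀ a b : A, ∃ x : A, x = ul a (lr b x) ∧ a = ur x b ∧ b = ll (lr b x) a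
  ax5_ur : ∀ a b c : A, ur (ur a b) c = ur (ur a (lr c b)) (ur b c)
  ax5_ur_var : ∀ a b c : A, ul (ul a b) c = ul (ul a (ll c b)) (ul b c)
  ax5_lr : ∀ a b c : A, lr (lr a b) c = lr (lr a (ur c b)) (lr b c)
  ax5_lr_var : ∀ a b c : A, ll (ll a b) c = ll (ll a (ul c b)) (ll b c)
  ax5_mix : ∀ a b c : A, ur (lr a b) (lr c (ur b a)) = lr (ur a c) (ur b (lr c a))
  ax5_mix_var : ∀ a b c : A, ul (ll a b) (ll c (ul b a)) = ll (ul a c) (ul b (ll c a))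

open BiquandleOps in
/-- An isomorphism of biquandles: a bijection that respects the four operations. -/
structure BiquandleIso (A B : Type*) [Biquandle A] [Biquandle B] extends A ≃ B where
  map_ur : ∀ a b, toFun (ur a b) = ur (toFun a) (toFun b)
  map_lr : ∀ a b, toFun (lr a b) = lr (toFun a) (toFun b)
  map_ul : ∀ a b, toFun (ul a b) = ul (toFun a) (toFun b)
  map_ll : ∀ a b, toFun (ll a b) = ll (toFun a) (toFun b)

/-! ### Generators and relations -/

/-- Formal expressions in generators `α` and the four operations. -/
inductive BWord (α : Type*) where
  | gen : α → BWord α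
  | ur : BWord α → BWord α → BWord α
  | lr : BWord α → BWord α → BWord α
  | ul : BWord α → BWord α → BWord α
  | ll : BWord α → BWord α → BWord α

/-- Value of an expression when the generators are given the values `g`. -/
def BWord.eval {α A : Type*} [BiquandleOps A] (g : α → A) : BWord α → A
  | .gen a => g a
  | .ur s t => BiquandleOps.ur (s.eval g) (t.eval g)
  | .lr s t => BiquandleOps.lr (s.eval g) (t.eval g)
  | .ul s t => BiquandleOps.ul (s.eval g) (t.eval g)
  | .ll s t => BiquandleOps.ll (s.eval g) (t.eval g)

/-- Expressions in the generators, the four operations, and one operation for each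
element whose existence a biquandle axiom asserts. -/
inductive BTerm (α : Type*) where
  | gen : α → BTerm α
  | ur : BTerm α → BTerm α → BTerm α
  | lr : BTerm α → BTerm α → BTerm α
  | ul : BTerm α → BTerm α → BTerm α
  | ll : BTerm α → BTerm α → BTerm α
  | x1 : BTerm α → BTerm α
  | x1v : BTerm α → BTerm α
  | x2 : BTerm α → BTerm α
  | x2v : BTerm α → BTerm α
  | x4 : BTerm α → BTerm α → BTerm α
  | x4v : BTerm α → BTerm α → BTerm α

instance BTerm.instOps {α : Type*} : BiquandleOps (BTerm α) := ⟨.ur, .lr, .ul, .ll⟩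

/-- The congruence on terms generated by the biquandle axioms and the relations `r`. -/
inductive BTerm.Rel {α : Type*} (r : BWord α → BWord α → Prop) : BTerm α → BTerm α → Prop
  | refl (a) : Rel r a a
  | symm {a b} : Rel r a b → Rel r b a
  | trans {a b c} : Rel r a b → Rel r b c → Rel r a c
  | congr_ur {a a' b b'} : Rel r a a' → Rel r b b' → Rel r (.ur a b) (.ur a' b')
  | congr_lr {a a' b b'} : Rel r a a' → Rel r b b' → Rel r (.lr a b) (.lr a' b')
  | congr_ul {a a' b b'} : Rel r a a' → Rel r b b' → Rel r (.ul a b) (.ul a' b')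
  | congr_ll {a a' b b'} : Rel r a a' → Rel r b b' → Rel r (.ll a b) (.ll a' b')
  | congr_x1 {a a'} : Rel r a a' → Rel r (.x1 a) (.x1 a')
  | congr_x1v {a a'} : Rel r a a' → Rel r (.x1v a) (.x1v a')
  | congr_x2 {a a'} : Rel r a a' → Rel r (.x2 a) (.x2 a')
  | congr_x2v {a a'} : Rel r a a' → Rel r (.x2v a) (.x2v a')
  | congr_x4 {a a' b b'} : Rel r a a' → Rel r b b' → Rel r (.x4 a b) (.x4 a' b')
  | congr_x4v {a a' b b'} : Rel r a a' → Rel r b b' → Rel r (.x4v a b) (.x4v a' b')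
  | rel {s t : BWord α} : r s t → Rel r (s.eval BTerm.gen) (t.eval BTerm.gen)
  | ax1 (a) : Rel r (.lr (.ur a (.x1 a)) a) a
  | ax1_var (a) : Rel r (.ll (.ul a (.x1v a)) a) a
  | ax2_l (a) : Rel r (.x2 a) (.ll a (.x2 a))
  | ax2_r (a) : Rel r a (.ul (.x2 a) a)
  | ax2_var_l (a) : Rel r (.x2v a) (.lr a (.x2v a))
  | ax2_var_r (a) : Rel r a (.ur (.x2v a) a)
  | ax3_lr (a b) : Rel r a (.ll (.lr a b) (.ur b a))
  | ax3_ur (a b) : Rel r a (.ul (.ur a b) (.lr b a))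
  | ax3_ul (a b) : Rel r a (.ur (.ul a b) (.ll b a))
  | ax3_ll (a b) : Rel r a (.lr (.ll a b) (.ul b a))
  | ax4_x (a b) : Rel r (.x4 a b) (.ur a (.ll b (.x4 a b)))
  | ax4_a (a b) : Rel r a (.ul (.x4 a b) b)
  | ax4_b (a b) : Rel r b (.lr (.ll b (.x4 a b)) a)
  | ax4_var_x (a b) : Rel r (.x4v a b) (.ul a (.lr b (.x4v a b)))
  | ax4_var_a (a b) : Rel r a (.ur (.x4v a b) b)
  | ax4_var_b (a b) : Rel r b (.ll (.lr b (.x4v a b)) a)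
  | ax5_ur (a b c) : Rel r (.ur (.ur a b) c) (.ur (.ur a (.lr c b)) (.ur b c))
  | ax5_ur_var (a b c) : Rel r (.ul (.ul a b) c) (.ul (.ul a (.ll c b)) (.ul b c))
  | ax5_lr (a b c) : Rel r (.lr (.lr a b) c) (.lr (.lr a (.ur c b)) (.lr b c))
  | ax5_lr_var (a b c) : Rel r (.ll (.ll a b) c) (.ll (.ll a (.ul c b)) (.ll b c))
  | ax5_mix (a b c) :
      Rel r (.ur (.lr a b) (.lr c (.ur b a))) (.lr (.ur a c) (.ur b (.lr c a)))
  | ax5_mix_var (a b c) :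
      Rel r (.ul (.ll a b) (.ll c (.ul b a))) (.ll (.ul a c) (.ul b (.ll c a)))

def BTerm.setoid {α : Type*} (r : BWord α → BWord α → Prop) : Setoid (BTerm α) :=
  ⟨BTerm.Rel r, .refl, .symm, .trans⟩

/-- The biquandle with generators `α` and relations `r`. -/
def PresentedBiquandle {α : Type*} (r : BWord α → BWord α → Prop) : Type _ :=
  Quotient (BTerm.setoid r)

instance PresentedBiquandle.instBiquandle {α : Type*} (r : BWord α → BWord α → Prop) :
    Biquandle (PresentedBiquandle r) where
  ur := Quotient.map₂ BTerm.ur fun _ _ h _ _ k => .congr_ur h k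
  lr := Quotient.map₂ BTerm.lr fun _ _ h _ _ k => .congr_lr h k
  ul := Quotient.map₂ BTerm.ul fun _ _ h _ _ k => .congr_ul h k
  ll := Quotient.map₂ BTerm.ll fun _ _ h _ _ k => .congr_ll h k
  ax1 := by
    rintro ⟨a⟩; exact ⟨Quotient.mk _ (.x1 a), Quotient.sound (.ax1 a)⟩
  ax1_var := by
    rintro ⟨a⟩; exact ⟨Quotient.mk _ (.x1v a), Quotient.sound (.ax1_var a)⟩
  ax2 := by
    rintro ⟨a⟩
    exact ⟨Quotient.mk _ (.x2 a), Quotient.sound (.ax2_l a), Quotient.sound (.ax2_r a)⟩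
  ax2_var := by
    rintro ⟨a⟩
    exact ⟨Quotient.mk _ (.x2v a), Quotient.sound (.ax2_var_l a), Quotient.sound (.ax2_var_r a)⟩
  ax3_lr := by rintro ⟨a⟩ ⟨b⟩; exact Quotient.sound (.ax3_lr a b)
  ax3_ur := by rintro ⟨a⟩ ⟨b⟩; exact Quotient.sound (.ax3_ur a b)
  ax3_ul := by rintro ⟨a⟩ ⟨b⟩; exact Quotient.sound (.ax3_ul a b)
  ax3_ll := by rintro ⟨a⟩ ⟨b⟩; exact Quotient.sound (.ax3_ll a b)
  ax4 := by
    rintro ⟨a⟩ ⟨b⟩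
    exact ⟨Quotient.mk _ (.x4 a b), Quotient.sound (.ax4_x a b), Quotient.sound (.ax4_a a b),
      Quotient.sound (.ax4_b a b)⟩
  ax4_var := by
    rintro ⟨a⟩ ⟨b⟩
    exact ⟨Quotient.mk _ (.x4v a b), Quotient.sound (.ax4_var_x a b),
      Quotient.sound (.ax4_var_a a b), Quotient.sound (.ax4_var_b a b)⟩
  ax5_ur := by rintro ⟨a⟩ ⟨b⟩ ⟨c⟩; exact Quotient.sound (.ax5_ur a b c)
  ax5_ur_var := by rintro ⟨a⟩ ⟨b⟩ ⟨c⟩; exact Quotient.sound (.ax5_ur_var a b c)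
  ax5_lr := by rintro ⟨a⟩ ⟨b⟩ ⟨c⟩; exact Quotient.sound (.ax5_lr a b c)
  ax5_lr_var := by rintro ⟨a⟩ ⟨b⟩ ⟨c⟩; exact Quotient.sound (.ax5_lr_var a b c)
  ax5_mix := by rintro ⟨a⟩ ⟨b⟩ ⟨c⟩; exact Quotient.sound (.ax5_mix a b c)
  ax5_mix_var := by rintro ⟨a⟩ ⟨b⟩ ⟨c⟩; exact Quotient.sound (.ax5_mix_var a b c)

/-! ### Virtual knot diagrams -/

/-- A disjoint union of `n` oriented circles. -/
abbrev Circles (n : ℕ) : Type := Fin n × UnitAddCircle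

/-- The point reached from `p` by moving `s` along its circle. -/
def Circles.move {n : ℕ} (p : Circles n) (s : ℝ) : Circles n := (p.1, p.2 + (s : UnitAddCircle))

/-- Velocity at `p` of a map from the circles to the plane. -/
noncomputable def Circles.velocity {n : ℕ} (γ : Circles n → ℝ × ℝ) (p : Circles n) : ℝ × ℝ :=
  deriv (fun s : ℝ => γ (p.move s)) 0

def planeDet (v w : ℝ × ℝ) : ℝ := v.1 * w.2 - v.2 * w.1

/-- An oriented virtual knot (or link) diagram with `n` components: a generic smooth immersion of
`n` oriented circles in the plane, every double point of which is labelled as a real crossing, with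
one strand over the other, or as a virtual crossing. -/
structure VirtualKnotDiagram (n : ℕ) where
  toFun : Circles n → ℝ × ℝ
  smooth : ∀ p : Circles n, ContDiff ℝ ∞ fun s : ℝ => toFun (p.move s)
  immersion : ∀ p, Circles.velocity toFun p ≠ 0
  finite_double : {x : Circles n × Circles n | x.1 ≠ x.2 ∧ toFun x.1 = toFun x.2}.Finite
  no_triple : ∀ p q r, p ≠ q → q ≠ r → p ≠ r → toFun p = toFun q → toFun q ≠ toFun r
  transverse : ∀ p q, p ≠ q → toFun p = toFun q →
    planeDet (Circles.velocity toFun p) (Circles.velocity toFun q) ≠ 0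
  /-- `IsOver p q`: the strands at `p` and `q` meet in a real crossing, and `p` lies on the over
  strand. A double point `{p, q}` with neither `IsOver p q` nor `IsOver q p` is virtual. -/
  IsOver : Circles n → Circles n → Prop
  isOver_double : ∀ p q, IsOver p q → p ≠ q ∧ toFun p = toFun q
  isOver_asymm : ∀ p q, IsOver p q → ¬ IsOver q p

namespace VirtualKnotDiagram

variable {n : ℕ}

/-- The points of the circles that lie at a real crossing. -/
def realPoints (K : VirtualKnotDiagram n) : Set (Circles n) :=
  {p | ∃ q, K.IsOver p q ∨ K.IsOver q p}

/-- The arcs of a diagram run from one real crossing to the next (over or under), through virtual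
crossings; a circle without real crossings is one arc. -/
def Arc (K : VirtualKnotDiagram n) : Type :=
  ConnectedComponents {p : Circles n // p ∉ K.realPoints}

/-- The arc `a` enters `p`. -/
def IsIn (K : VirtualKnotDiagram n) (p : Circles n) (a : K.Arc) : Prop :=
  ∀ᶠ s : ℝ in 𝓝[>] 0, ∃ h : p.move (-s) ∉ K.realPoints, ConnectedComponents.mk ⟨_, h⟩ = a

/-- The arc `a` leaves `p`. -/
def IsOut (K : VirtualKnotDiagram n) (p : Circles n) (a : K.Arc) : Prop :=
  ∀ᶠ s : ℝ in 𝓝[>] 0, ∃ h : p.move s ∉ K.realPoints, ConnectedComponents.mk ⟨_, h⟩ = a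

/-- At the real crossing with over strand through `p` and under strand through `q`, the over strand
comes in along the arc `o` and goes out along `o'`, the under strand in along `u` and out along
`u'`. -/
def CrossingArcs (K : VirtualKnotDiagram n) (p q : Circles n) (o o' u u' : K.Arc) : Prop :=
  K.IsOver p q ∧ K.IsIn p o ∧ K.IsOut p o' ∧ K.IsIn q u ∧ K.IsOut q u'

/-- Orientation of the frame (over strand, under strand): positive at a positive crossing. -/
noncomputable def crossingDet (K : VirtualKnotDiagram n) (p q : Circles n) : ℝ :=
  planeDet (Circles.velocity K.toFun p) (Circles.velocity K.toFun q)

/-- The two relations of each real crossing. -/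
inductive CrossingRel (K : VirtualKnotDiagram n) : BWord K.Arc → BWord K.Arc → Prop
  | pos_over {p q o o' u u'} : K.CrossingArcs p q o o' u u' → 0 < K.crossingDet p q →
      CrossingRel K (.gen o') (.lr (.gen o) (.gen u))
  | pos_under {p q o o' u u'} : K.CrossingArcs p q o o' u u' → 0 < K.crossingDet p q →
      CrossingRel K (.gen u') (.ur (.gen u) (.gen o))
  | neg_over {p q o o' u u'} : K.CrossingArcs p q o o' u u' → K.crossingDet p q < 0 →
      CrossingRel K (.gen o') (.ll (.gen o) (.gen u))
  | neg_under {p q o o' u u'} : K.CrossingArcs p q o o' u u' → K.crossingDet p q < 0 →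
      CrossingRel K (.gen u') (.ul (.gen u) (.gen o))

/-- `BQ(K)`: one generator for each arc, two relations for each real crossing. -/
def BQ (K : VirtualKnotDiagram n) : Type := PresentedBiquandle K.CrossingRel

instance (K : VirtualKnotDiagram n) : Biquandle K.BQ :=
  inferInstanceAs (Biquandle (PresentedBiquandle K.CrossingRel))

/-- `A` is a biquandle for the diagram `K`: it is generated by elements, one for each arc, that
satisfy the relations of the crossings. -/
def IsBiquandleFor (K : VirtualKnotDiagram n) (A : Type*) [Biquandle A] : Prop :=
  ∃ g : K.Arc → A, (∀ s t, K.CrossingRel s t → s.eval g = t.eval g) ∧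
    ∀ x : A, ∃ w : BWord K.Arc, w.eval g = x

end VirtualKnotDiagram

/-! ### The vertical mirror image -/

/-- Reversal of the orientation of every circle. -/
def Circles.rev {n : ℕ} (p : Circles n) : Circles n := (p.1, -p.2)

/-- Reflection of the plane in a vertical line. -/
def planeReflect (v : ℝ × ℝ) : ℝ × ℝ := (-v.1, v.2)

theorem Circles.rev_rev {n : ℕ} (p : Circles n) : p.rev.rev = p := by
  simp [Circles.rev]

theorem Circles.rev_injective {n : ℕ} : Function.Injective (Circles.rev (n := n)) :=
  Function.LeftInverse.injective Circles.rev_rev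

theorem Circles.rev_move {n : ℕ} (p : Circles n) (s : ℝ) :
    (p.move s).rev = p.rev.move (-s) := by
  simp [Circles.rev, Circles.move, add_comm]

theorem planeReflect_injective : Function.Injective planeReflect := by
  rintro ⟨a, b⟩ ⟨c, d⟩ h
  simpa [planeReflect] using h

namespace VirtualKnotDiagram

variable {n : ℕ}

theorem velocity_reflect_rev (K : VirtualKnotDiagram n) (p : Circles n) :
    Circles.velocity (fun q => planeReflect (K.toFun q.rev)) p =
      ((Circles.velocity K.toFun p.rev).1, -(Circles.velocity K.toFun p.rev).2) := by
  have hd : HasDerivAt (fun s : ℝ => K.toFun (p.rev.move s)) (Circles.velocity K.toFun p.rev) 0 :=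
    (((K.smooth p.rev).differentiable (by simp)) 0).hasDerivAt
  have hd' : HasDerivAt (fun s : ℝ => K.toFun (p.rev.move (-s)))
      (-(Circles.velocity K.toFun p.rev)) 0 := by
    have h0 : HasDerivAt (fun s : ℝ => K.toFun (p.rev.move s))
        (Circles.velocity K.toFun p.rev) (-0) := by simpa using hd
    have h := h0.scomp (0 : ℝ) (hasDerivAt_neg (0 : ℝ))
    rw [neg_one_smul] at h
    exact h
  have h1 : HasDerivAt (fun s : ℝ => (K.toFun (p.rev.move (-s))).1)
      (-(Circles.velocity K.toFun p.rev)).1 0 :=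
    (ContinuousLinearMap.fst ℝ ℝ ℝ).hasFDerivAt.comp_hasDerivAt (0 : ℝ) hd'
  have h2 : HasDerivAt (fun s : ℝ => (K.toFun (p.rev.move (-s))).2)
      (-(Circles.velocity K.toFun p.rev)).2 0 :=
    (ContinuousLinearMap.snd ℝ ℝ ℝ).hasFDerivAt.comp_hasDerivAt (0 : ℝ) hd'
  have h3 := (h1.neg.prodMk h2).deriv
  simp only [Circles.velocity, Circles.rev_move, planeReflect] at h3 ⊢
  refine Eq.trans ?_ (h3.trans ?_)
  · rfl
  · simp

/-- The vertical mirror image of a diagram: the diagram is reflected in a vertical line of the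
plane, over strands stay over strands and virtual crossings stay virtual, and all components are
traversed backwards. So the vertical mirror image of the closure of a braid is the closure
of the inverse braid. -/
def verticalMirror (K : VirtualKnotDiagram n) : VirtualKnotDiagram n where
  toFun p := planeReflect (K.toFun p.rev)
  smooth p := by
    have h : ContDiff ℝ ∞ fun s : ℝ => K.toFun (p.rev.move (-s)) :=
      (K.smooth p.rev).comp contDiff_neg
    simp only [Circles.rev_move, planeReflect]
    exact h.fst.neg.prodMk h.snd
  immersion p h := by
    apply K.immersion p.rev
    rw [velocity_reflect_rev] at h
    simpa [Prod.ext_iff] using h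
  finite_double := by
    refine (K.finite_double.preimage (f := Prod.map Circles.rev Circles.rev)
      (Circles.rev_injective.prodMap Circles.rev_injective).injOn).subset ?_
    rintro ⟨p, q⟩ ⟨h1, h2⟩
    exact ⟨fun h => h1 (Circles.rev_injective h), planeReflect_injective h2⟩
  no_triple p q r h1 h2 h3 h4 h5 :=
    K.no_triple p.rev q.rev r.rev (Circles.rev_injective.ne h1) (Circles.rev_injective.ne h2)
      (Circles.rev_injective.ne h3) (planeReflect_injective h4) (planeReflect_injective h5)
  transverse p q h1 h2 := by
    have := K.transverse p.rev q.rev (Circles.rev_injective.ne h1) (planeReflect_injective h2)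
    rw [velocity_reflect_rev, velocity_reflect_rev]
    intro h
    apply this
    simp only [planeDet] at h ⊢
    linarith
  IsOver p q := K.IsOver p.rev q.rev
  isOver_double p q h :=
    ⟨fun e => (K.isOver_double _ _ h).1 (congrArg Circles.rev e),
      congrArg planeReflect (K.isOver_double _ _ h).2⟩
  isOver_asymm p q h := K.isOver_asymm _ _ h

end VirtualKnotDiagram

open BiquandleOps

/-! Reflecting the plane reverses the sign of every crossing; reversing all strands preserves the
sign but exchanges incoming and outgoing arcs. So a positive crossing, with $o'=o_u$ and $u'=u^o$,
becomes a negative one whose relations read $o=o'_{\overline{u'}}$ and $u=u'^{\overline{o'}}$. By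
axiom (3) the two pairs of relations are equivalent in every biquandle
(`Biquandle.positive_iff_negative`). Under the bijection of arcs `arcMirror`, the two diagrams
therefore impose equivalent conditions on a labelling of the arcs by any biquandle
(`satisfiesRelations_verticalMirror`).

The claim about biquandles for $K$ follows by transporting labellings. For $BQ$, the equivalence is
applied to the tautological labellings of both presented biquandles, and `isoOfEquiv` gives the
isomorphism. It acts by renaming generators, which commutes with all operations on terms, including
those that stand for the elements of axioms (1), (2), (4). -/

/-! ### Functoriality of presentations -/

/-- Renaming of the generators of a term. -/
def BTerm.map {α β : Type*} (f : α → β) : BTerm α → BTerm β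
  | .gen a => .gen (f a)
  | .ur s t => .ur (s.map f) (t.map f)
  | .lr s t => .lr (s.map f) (t.map f)
  | .ul s t => .ul (s.map f) (t.map f)
  | .ll s t => .ll (s.map f) (t.map f)
  | .x1 s => .x1 (s.map f)
  | .x1v s => .x1v (s.map f)
  | .x2 s => .x2 (s.map f)
  | .x2v s => .x2v (s.map f)
  | .x4 s t => .x4 (s.map f) (t.map f)
  | .x4v s t => .x4v (s.map f) (t.map f)

theorem BTerm.map_map_of_leftInverse {α β : Type*} {f : α → β} {g : β → α}
    (h : Function.LeftInverse g f) (t : BTerm α) : (t.map f).map g = t := by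
  induction t <;> simp_all [BTerm.map, h _]

theorem BWord.map_eval_gen {α β : Type*} (f : α → β) (w : BWord α) :
    (w.eval BTerm.gen).map f = w.eval fun a => BTerm.gen (f a) := by
  induction w with
  | gen a => rfl
  | ur s t hs ht => exact congrArg₂ BTerm.ur hs ht
  | lr s t hs ht => exact congrArg₂ BTerm.lr hs ht
  | ul s t hs ht => exact congrArg₂ BTerm.ul hs ht
  | ll s t hs ht => exact congrArg₂ BTerm.ll hs ht

/-- Renaming of the generators of an expression. -/
def BWord.map {α β : Type*} (f : α → β) : BWord α → BWord β
  | .gen a => .gen (f a)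
  | .ur s t => .ur (s.map f) (t.map f)
  | .lr s t => .lr (s.map f) (t.map f)
  | .ul s t => .ul (s.map f) (t.map f)
  | .ll s t => .ll (s.map f) (t.map f)

theorem BWord.eval_map {α β A : Type*} [BiquandleOps A] (f : α → β) (g : β → A) (w : BWord α) :
    (w.map f).eval g = w.eval (g ∘ f) := by
  induction w <;> simp_all [BWord.map, BWord.eval]

/-- The values `g` of the generators satisfy the relations `r`. -/
def SatisfiesRelations {α A : Type*} [BiquandleOps A] (r : BWord α → BWord α → Prop)
    (g : α → A) : Prop :=
  ∀ s t, r s t → s.eval g = t.eval g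

namespace PresentedBiquandle

variable {α β : Type*} {r : BWord α → BWord α → Prop} {r' : BWord β → BWord β → Prop}

/-- The class of a term. -/
def mk (r : BWord α → BWord α → Prop) (t : BTerm α) : PresentedBiquandle r :=
  Quotient.mk (BTerm.setoid r) t

/-- The generators of a presented biquandle. -/
def of (r : BWord α → BWord α → Prop) (a : α) : PresentedBiquandle r :=
  mk r (.gen a)

theorem eval_mk (r' : BWord β → BWord β → Prop) (g : α → BTerm β) (w : BWord α) :
    w.eval (fun a => mk r' (g a)) = mk r' (w.eval g) := by
  induction w with
  | gen a => rfl
  | ur s t hs ht => exact congrArg₂ ur hs ht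
  | lr s t hs ht => exact congrArg₂ lr hs ht
  | ul s t hs ht => exact congrArg₂ ul hs ht
  | ll s t hs ht => exact congrArg₂ ll hs ht

/-- Translates relations that hold in the quotient into statements about renamed terms, as `rel_map`
needs. -/
theorem eval_of_comp (r' : BWord β → BWord β → Prop) (f : α → β) (w : BWord α) :
    w.eval (of r' ∘ f) = mk r' ((w.eval BTerm.gen).map f) := by
  rw [BWord.map_eval_gen]
  exact eval_mk r' (fun a => .gen (f a)) w

theorem satisfiesRelations_of (r : BWord α → BWord α → Prop) : SatisfiesRelations r (of r) :=
  fun s t h => (eval_mk r .gen s).trans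
    (.trans (Quotient.sound (BTerm.Rel.rel h)) (eval_mk r .gen t).symm)

theorem rel_map {f : α → β} (h : SatisfiesRelations r (of r' ∘ f)) {a b : BTerm α}
    (hab : BTerm.Rel r a b) : BTerm.Rel r' (a.map f) (b.map f) := by
  induction hab with
  | refl => exact .refl _
  | symm _ ih => exact ih.symm
  | trans _ _ ih ih' => exact ih.trans ih'
  | congr_ur _ _ ih ih' => exact .congr_ur ih ih'
  | congr_lr _ _ ih ih' => exact .congr_lr ih ih'
  | congr_ul _ _ ih ih' => exact .congr_ul ih ih'
  | congr_ll _ _ ih ih' => exact .congr_ll ih ih'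
  | congr_x1 _ ih => exact .congr_x1 ih
  | congr_x1v _ ih => exact .congr_x1v ih
  | congr_x2 _ ih => exact .congr_x2 ih
  | congr_x2v _ ih => exact .congr_x2v ih
  | congr_x4 _ _ ih ih' => exact .congr_x4 ih ih'
  | congr_x4v _ _ ih ih' => exact .congr_x4v ih ih'
  -- The only case that uses `h`: an equality in the quotient is turned back into a derivation. The
  -- axioms are stable under renaming.
  | rel hst =>
    have := h _ _ hst
    rw [eval_of_comp, eval_of_comp] at this
    exact Quotient.exact this
  | ax1 => exact .ax1 _
  | ax1_var => exact .ax1_var _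
  | ax2_l => exact .ax2_l _
  | ax2_r => exact .ax2_r _
  | ax2_var_l => exact .ax2_var_l _
  | ax2_var_r => exact .ax2_var_r _
  | ax3_lr => exact .ax3_lr _ _
  | ax3_ur => exact .ax3_ur _ _
  | ax3_ul => exact .ax3_ul _ _
  | ax3_ll => exact .ax3_ll _ _
  | ax4_x => exact .ax4_x _ _
  | ax4_a => exact .ax4_a _ _
  | ax4_b => exact .ax4_b _ _
  | ax4_var_x => exact .ax4_var_x _ _
  | ax4_var_a => exact .ax4_var_a _ _
  | ax4_var_b => exact .ax4_var_b _ _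
  | ax5_ur => exact .ax5_ur _ _ _
  | ax5_ur_var => exact .ax5_ur_var _ _ _
  | ax5_lr => exact .ax5_lr _ _ _
  | ax5_lr_var => exact .ax5_lr_var _ _ _
  | ax5_mix => exact .ax5_mix _ _ _
  | ax5_mix_var => exact .ax5_mix_var _ _ _

/-- A bijection of the generators under which each of two sets of relations holds in the
biquandle presented by the other induces an isomorphism. -/
def isoOfEquiv (e : α ≃ β) (h : SatisfiesRelations r (of r' ∘ e))
    (h' : SatisfiesRelations r' (of r ∘ e.symm)) :
    BiquandleIso (PresentedBiquandle r) (PresentedBiquandle r') where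
  toFun := Quotient.map (BTerm.map e) fun _ _ => rel_map h
  invFun := Quotient.map (BTerm.map e.symm) fun _ _ => rel_map h'
  left_inv := by
    rintro ⟨a⟩
    exact congrArg (Quotient.mk _) (BTerm.map_map_of_leftInverse e.left_inv a)
  right_inv := by
    rintro ⟨a⟩
    exact congrArg (Quotient.mk _) (BTerm.map_map_of_leftInverse e.right_inv a)
  map_ur := by rintro ⟨a⟩ ⟨b⟩; rfl
  map_lr := by rintro ⟨a⟩ ⟨b⟩; rfl
  map_ul := by rintro ⟨a⟩ ⟨b⟩; rfl
  map_ll := by rintro ⟨a⟩ ⟨b⟩; rfl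

end PresentedBiquandle

/-! ### Inverting the relations of a crossing -/

/-- Axiom (3) says exactly that the maps $(o,u)\mapsto(o_u,u^o)$ and
$(o',u')\mapsto(o'_{\overline{u'}},u'^{\overline{o'}})$ are mutually inverse. -/
theorem Biquandle.positive_iff_negative {A : Type*} [Biquandle A] (o o' u u' : A) :
    (o' = lr o u ∧ u' = ur u o) ↔ (o = ll o' u' ∧ u = ul u' o') := by
  constructor
  · rintro ⟨rfl, rfl⟩
    exact ⟨Biquandle.ax3_lr o u, Biquandle.ax3_ur u o⟩
  · rintro ⟨rfl, rfl⟩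
    exact ⟨Biquandle.ax3_ll o' u', Biquandle.ax3_ul u' o'⟩

theorem Circles.continuous_rev {n : ℕ} : Continuous (Circles.rev (n := n)) :=
  continuous_fst.prodMk continuous_snd.neg

/-! ### The arcs and relations of the vertical mirror image -/

namespace VirtualKnotDiagram

variable {n : ℕ} (K : VirtualKnotDiagram n)

theorem mem_realPoints_verticalMirror {p : Circles n} :
    p ∈ K.verticalMirror.realPoints ↔ p.rev ∈ K.realPoints := by
  constructor
  · rintro ⟨q, h⟩
    exact ⟨q.rev, h⟩
  · rintro ⟨q, h⟩
    refine ⟨q.rev, ?_⟩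
    change K.IsOver p.rev q.rev.rev ∨ K.IsOver q.rev.rev p.rev
    rwa [Circles.rev_rev]

theorem rev_mem_realPoints_verticalMirror {p : Circles n} :
    p.rev ∈ K.verticalMirror.realPoints ↔ p ∈ K.realPoints := by
  rw [mem_realPoints_verticalMirror, Circles.rev_rev]

/-- Reversal identifies the points away from the real crossings of a diagram with those of its
vertical mirror image. -/
def complementMirror :
    {p : Circles n // p ∉ K.realPoints} ≃ₜ {p : Circles n // p ∉ K.verticalMirror.realPoints} where
  toFun p := ⟨p.1.rev, fun h => p.2 (K.rev_mem_realPoints_verticalMirror.1 h)⟩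
  invFun p := ⟨p.1.rev, fun h => p.2 (K.mem_realPoints_verticalMirror.2 h)⟩
  left_inv p := Subtype.ext p.1.rev_rev
  right_inv p := Subtype.ext p.1.rev_rev
  continuous_toFun := (Circles.continuous_rev.comp continuous_subtype_val).subtype_mk _
  continuous_invFun := (Circles.continuous_rev.comp continuous_subtype_val).subtype_mk _

/-- The arcs of a diagram correspond to those of its vertical mirror image. -/
def arcMirror : K.Arc ≃ K.verticalMirror.Arc where
  toFun := K.complementMirror.continuous.connectedComponentsMap
  invFun := K.complementMirror.symm.continuous.connectedComponentsMap
  left_inv a := by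
    obtain ⟨p, rfl⟩ := ConnectedComponents.surjective_coe a
    exact congrArg ConnectedComponents.mk (K.complementMirror.symm_apply_apply p)
  right_inv a := by
    obtain ⟨p, rfl⟩ := ConnectedComponents.surjective_coe a
    exact congrArg ConnectedComponents.mk (K.complementMirror.apply_symm_apply p)

/-- `q` is kept separate from `p.rev` because `IsIn` and `IsOut` produce points `p.rev.move _`,
which are reversals only up to a rewrite. -/
theorem exists_arc_mirror_iff {p q : Circles n} (hq : q = p.rev) (a : K.Arc) :
    (∃ h : q ∉ K.verticalMirror.realPoints,
        (ConnectedComponents.mk ⟨q, h⟩ : K.verticalMirror.Arc) = K.arcMirror a) ↔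
      ∃ h : p ∉ K.realPoints, (ConnectedComponents.mk ⟨p, h⟩ : K.Arc) = a := by
  subst hq
  have key (h : p ∉ K.realPoints) (h' : p.rev ∉ K.verticalMirror.realPoints) :
      (ConnectedComponents.mk ⟨p.rev, h'⟩ : K.verticalMirror.Arc) =
        K.arcMirror (ConnectedComponents.mk ⟨p, h⟩) := rfl
  constructor
  · rintro ⟨h', e⟩
    have h := fun hp => h' (K.rev_mem_realPoints_verticalMirror.2 hp)
    exact ⟨h, K.arcMirror.injective ((key h h').symm.trans e)⟩
  · rintro ⟨h, rfl⟩
    exact ⟨fun hp => h (K.rev_mem_realPoints_verticalMirror.1 hp), key h _⟩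

theorem isOut_verticalMirror {p : Circles n} {a : K.Arc} :
    K.verticalMirror.IsOut p.rev (K.arcMirror a) ↔ K.IsIn p a :=
  eventually_congr (.of_forall fun s =>
    K.exists_arc_mirror_iff (by rw [Circles.rev_move, neg_neg]) a)

theorem isIn_verticalMirror {p : Circles n} {a : K.Arc} :
    K.verticalMirror.IsIn p.rev (K.arcMirror a) ↔ K.IsOut p a :=
  eventually_congr (.of_forall fun s => K.exists_arc_mirror_iff (by rw [Circles.rev_move]) a)

theorem crossingArcs_verticalMirror {p q : Circles n} {o o' u u' : K.Arc} :
    K.verticalMirror.CrossingArcs p.rev q.rev (K.arcMirror o') (K.arcMirror o) (K.arcMirror u')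
      (K.arcMirror u) ↔ K.CrossingArcs p q o o' u u' := by
  have h : K.verticalMirror.IsOver p.rev q.rev ↔ K.IsOver p q := by
    change K.IsOver p.rev.rev q.rev.rev ↔ _
    rw [Circles.rev_rev, Circles.rev_rev]
  simp only [CrossingArcs, h, isIn_verticalMirror, isOut_verticalMirror]
  tauto

/-- Reversal and reflection together act on velocities by $(v_1,v_2)\mapsto(v_1,-v_2)$, of
determinant $-1$. -/
theorem crossingDet_verticalMirror (p q : Circles n) :
    K.verticalMirror.crossingDet p.rev q.rev = -K.crossingDet p q := by
  have h (p : Circles n) : Circles.velocity K.verticalMirror.toFun p.rev =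
      ((Circles.velocity K.toFun p).1, -(Circles.velocity K.toFun p).2) := by
    have := K.velocity_reflect_rev p.rev
    rwa [Circles.rev_rev] at this
  simp only [crossingDet, h, planeDet]
  ring

/-- Groups the two relations of a crossing, since axiom (3) inverts them only as a pair. -/
theorem satisfiesRelations_crossingRel_iff {A : Type*} [BiquandleOps A] (g : K.Arc → A) :
    SatisfiesRelations K.CrossingRel g ↔ ∀ p q o o' u u', K.CrossingArcs p q o o' u u' →
      (0 < K.crossingDet p q → g o' = lr (g o) (g u) ∧ g u' = ur (g u) (g o)) ∧
      (K.crossingDet p q < 0 → g o' = ll (g o) (g u) ∧ g u' = ul (g u) (g o)) := by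
  constructor
  · intro h p q o o' u u' hc
    exact ⟨fun hd => ⟨h _ _ (.pos_over hc hd), h _ _ (.pos_under hc hd)⟩,
      fun hd => ⟨h _ _ (.neg_over hc hd), h _ _ (.neg_under hc hd)⟩⟩
  · rintro h _ _ (⟨hc, hd⟩ | ⟨hc, hd⟩ | ⟨hc, hd⟩ | ⟨hc, hd⟩)
    · exact ((h _ _ _ _ _ _ hc).1 hd).1
    · exact ((h _ _ _ _ _ _ hc).1 hd).2
    · exact ((h _ _ _ _ _ _ hc).2 hd).1
    · exact ((h _ _ _ _ _ _ hc).2 hd).2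

theorem satisfiesRelations_verticalMirror {A : Type*} [Biquandle A]
    (g : K.verticalMirror.Arc → A) :
    SatisfiesRelations K.CrossingRel (g ∘ K.arcMirror) ↔
      SatisfiesRelations K.verticalMirror.CrossingRel g := by
  rw [satisfiesRelations_crossingRel_iff, satisfiesRelations_crossingRel_iff]
  constructor
  · intro h p q o o' u u' hc
    -- All points and arcs of the mirror image are written as mirrors, so that the crossing comes
    -- from one of `K`.
    obtain ⟨p, rfl⟩ : ∃ p', p = Circles.rev p' := ⟨p.rev, p.rev_rev.symm⟩
    obtain ⟨q, rfl⟩ : ∃ q', q = Circles.rev q' := ⟨q.rev, q.rev_rev.symm⟩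
    obtain ⟨o, rfl⟩ := K.arcMirror.surjective o
    obtain ⟨o', rfl⟩ := K.arcMirror.surjective o'
    obtain ⟨u, rfl⟩ := K.arcMirror.surjective u
    obtain ⟨u', rfl⟩ := K.arcMirror.surjective u'
    obtain ⟨hp, hn⟩ := h _ _ _ _ _ _ (K.crossingArcs_verticalMirror.1 hc)
    rw [crossingDet_verticalMirror]
    exact ⟨fun hd => (Biquandle.positive_iff_negative _ _ _ _).2 (hn (neg_pos.1 hd)),
      fun hd => (Biquandle.positive_iff_negative _ _ _ _).1 (hp (neg_lt_zero.1 hd))⟩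
  · intro h p q o o' u u' hc
    obtain ⟨hp, hn⟩ := h _ _ _ _ _ _ (K.crossingArcs_verticalMirror.2 hc)
    rw [crossingDet_verticalMirror] at hp hn
    exact ⟨fun hd => (Biquandle.positive_iff_negative _ _ _ _).2 (hn (neg_lt_zero.2 hd)),
      fun hd => (Biquandle.positive_iff_negative _ _ _ _).1 (hp (neg_pos.2 hd))⟩

end VirtualKnotDiagram

theorem corollaryC {n : ℕ} (K : VirtualKnotDiagram n) :
    Nonempty (BiquandleIso K.BQ K.verticalMirror.BQ) ∧
      ∀ (A : Type*) [Biquandle A], K.IsBiquandleFor A ↔ K.verticalMirror.IsBiquandleFor A := by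
  refine ⟨⟨PresentedBiquandle.isoOfEquiv K.arcMirror ?_ ?_⟩, fun A _ => ⟨?_, ?_⟩⟩
  -- The labelling of the arcs of `K` by the generators of the mirror's biquandle; the next goal is
  -- the converse.
  · exact (K.satisfiesRelations_verticalMirror _).2 (PresentedBiquandle.satisfiesRelations_of _)
  · apply (K.satisfiesRelations_verticalMirror _).1
    rw [Function.comp_assoc, Equiv.symm_comp_self]
    exact PresentedBiquandle.satisfiesRelations_of _
  · rintro ⟨g, hg, hgen⟩
    have hc : (g ∘ K.arcMirror.symm) ∘ K.arcMirror = g := by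
      rw [Function.comp_assoc, Equiv.symm_comp_self, Function.comp_id]
    refine ⟨g ∘ K.arcMirror.symm, (K.satisfiesRelations_verticalMirror _).1 (hc.symm ▸ hg), ?_⟩
    intro x
    obtain ⟨w, rfl⟩ := hgen x
    -- Relabelling along a bijection of arcs leaves the generated elements unchanged.
    exact ⟨w.map K.arcMirror, by rw [BWord.eval_map, hc]⟩
  · rintro ⟨g, hg, hgen⟩
    refine ⟨g ∘ K.arcMirror, (K.satisfiesRelations_verticalMirror g).2 hg, fun x => ?_⟩
    obtain ⟨w, rfl⟩ := hgen x
    refine ⟨w.map K.arcMirror.symm, ?_⟩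
    rw [BWord.eval_map, Function.comp_assoc, Equiv.self_comp_symm, Function.comp_id]
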